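/- Let $N=\{1,\dots,n\}$ be a set of buyers whose valuations $v_1,\dots,v_n$ are i.i.d. on $[0,\bar v]$ with cdf $F$ and density $f$, where $f>0$ on $(0,\bar v)$ and $F$ is regular, i.e. the virtual valuation $\psi(x)=x-\frac{1-F(x)}{f(x)}$ is nondecreasing on $(0,\bar v)$. Let $\hat r\in(0,\bar v)$ be a solution of $\psi(x)=0$, and put $$\operatorname{OPT}(N)=\bar v-\hat r F^n(\hat r)-\int_{\hat r}^{\bar v}\left[nF^{n-1}(x)-(n-1)F^n(x)\right]dx .$$ Setting. A network is a directed graph on $N\cup\{s\}$, where $s$ is the seller; $e_a$ denotes the set of direct neighbours of agent $a$. The action of buyer $i$ is a bid $v_i'\in[0,\bar v]$ together with a set $e_i'\subseteq e_i$ of neighbours whom she informs; she is truthful if $v_i'=v_i$ and $e_i'=e_i$. The seller informs all of $e_s$, informed buyers pass the information on to $e_i'$, and exactly the informed buyers take part: a mechanism receives the actions of the informed buyers, and "nil" for the others, and returns an allocation $\pi_i\in\{0,1\}$ and a (possibly negative) payment $p_i$ for every buyer. It is feasible if $\sum_i\pi_i\le 1$ and $\pi_i=0$ for buyers who do not take part.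 It is individually rational (IR) if $\pi_iv_i-p_i\ge 0$ for every buyer $i$ who bids $v_i$, whichever of her neighbours she informs and whatever the others do. It is dominant-strategy incentive compatible (DSIC) if, for every buyer, being truthful maximizes $\pi_iv_i-p_i$ whatever the other buyers do. Its expected revenue on a network is the expectation of $\sum_i p_i$ when all buyers are truthful. Claim. 1. On every network in which all buyers are direct neighbours of the seller ($e_s=N$), Myerson's optimal auction among $N$, that is, the second-price auction with reserve price $\hat r$ (the item goes to a highest bidder, ties being broken by a fixed order of the buyers, provided that her bid is at least $\hat r$, and she pays the larger one of $\hat r$ and the highest bid of the other buyers), is feasible, IR and DSIC, and its expected revenue is exactly $\operatorname{OPT}(N)$. 2. For every network on $N\cup\{s\}$ and every feasible, IR and DSIC mechanism (with allocation and payments measurable in the valuations), the expected revenue is at most $\operatorname{OPT}(N)$. -/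

import Mathlib

open MeasureTheory ProbabilityTheory Set

namespace NetworkAuction

/-! ### Valuations -/

/-- The law of a single valuation: the measure on `[0, vbar]` with density `f`. -/
noncomputable def valueLaw (vbar : ℝ) (f : ℝ → ℝ) : Measure ℝ :=
  (volume.restrict (Icc 0 vbar)).withDensity (fun x => ENNReal.ofReal (f x))

/-- The cumulative distribution function `F` of a valuation. -/
noncomputable def valueCdf (vbar : ℝ) (f : ℝ → ℝ) (x : ℝ) : ℝ :=
  cdf (valueLaw vbar f) x

/-- The virtual valuation `x - (1 - F x) / f x`. -/
noncomputable def virtualValue (vbar : ℝ) (f : ℝ → ℝ) (x : ℝ) : ℝ :=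
  x - (1 - valueCdf vbar f x) / f x

/-- The distribution is regular: the virtual valuation is monotone on `(0, vbar)`. -/
def IsRegular (vbar : ℝ) (f : ℝ → ℝ) : Prop :=
  MonotoneOn (virtualValue vbar f) (Ioo 0 vbar)

/-! ### Networks, actions, diffusion -/

/-- The agents: `none` is the seller, `some i` is buyer `i`. -/
abbrev Agent (n : ℕ) : Type := Option (Fin n)

/-- The set of direct neighbours of an agent in the network `G`. -/
def neighbours {n : ℕ} (G : Digraph (Agent n)) (a : Agent n) : Set (Agent n) :=
  {b | G.Adj a b}

/-- An action of a buyer: her bid and the set of neighbours whom she informs of the sale. -/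
structure Action (n : ℕ) where
  bid : ℝ
  inform : Set (Agent n)

/-- Every buyer `i` bids in `[0, vbar]` and informs a subset of her own neighbours. -/
def ValidProfile {n : ℕ} (vbar : ℝ) (G : Digraph (Agent n)) (σ : Fin n → Action n) : Prop :=
  ∀ i, (σ i).bid ∈ Icc 0 vbar ∧ (σ i).inform ⊆ neighbours G (some i)

/-- The buyers who receive the sale information: it starts at the seller, who informs all of her
neighbours, and an informed buyer passes it on to the agents in her `inform` set. -/
inductive Informed {n : ℕ} (G : Digraph (Agent n)) (σ : Fin n → Action n) : Fin n → Prop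
  | seller {i : Fin n} : some i ∈ neighbours G none → Informed G σ i
  | step {i j : Fin n} : Informed G σ i → some j ∈ (σ i).inform → Informed G σ j

/-- What reaches the mechanism: the action of every informed buyer, and nil (`none`) for
every buyer to whom no diffusion path leads. -/
noncomputable def observed {n : ℕ} (G : Digraph (Agent n)) (σ : Fin n → Action n) :
    Fin n → Option (Action n) :=
  open Classical in fun i => if Informed G σ i then some (σ i) else none

/-- The profile in which every buyer bids her valuation and informs all of her neighbours. -/
def truthful {n : ℕ} (G : Digraph (Agent n)) (v : Fin n → ℝ) : Fin n → Action n :=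
  fun i => ⟨v i, neighbours G (some i)⟩

/-! ### Mechanisms -/

/-- A network auction mechanism: allocation and payments as functions of the received profile.
A negative payment is a transfer from the seller to the buyer. -/
structure Mechanism (n : ℕ) where
  alloc : (Fin n → Option (Action n)) → Fin n → ℝ
  pay : (Fin n → Option (Action n)) → Fin n → ℝ

/-- The utility of buyer `i` with true valuation `v` when the mechanism receives `t`. -/
def Mechanism.utility {n : ℕ} (M : Mechanism n) (v : ℝ) (t : Fin n → Option (Action n))
    (i : Fin n) : ℝ :=
  M.alloc t i * v - M.pay t i

/-- The allocation is 0/1-valued, gives the item to at most one buyer, and never to a buyer who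
does not take part. -/
def Mechanism.IsFeasible {n : ℕ} (M : Mechanism n) (vbar : ℝ) (G : Digraph (Agent n)) : Prop :=
  ∀ σ, ValidProfile vbar G σ →
    (∀ i, M.alloc (observed G σ) i = 0 ∨ M.alloc (observed G σ) i = 1) ∧
    ∑ i, M.alloc (observed G σ) i ≤ 1 ∧
    ∀ i, observed G σ i = none → M.alloc (observed G σ) i = 0

/-- Individual rationality: a buyer who bids her valuation has nonnegative utility, whichever of
her neighbours she informs and whatever the others do. -/
def Mechanism.IsIR {n : ℕ} (M : Mechanism n) (vbar : ℝ) (G : Digraph (Agent n)) : Prop :=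
  ∀ σ, ValidProfile vbar G σ → ∀ i, 0 ≤ M.utility (σ i).bid (observed G σ) i

/-- Dominant-strategy incentive compatibility: whatever the others do, a buyer with valuation `v`
does best by bidding `v` and informing all of her neighbours. Which of the other buyers take part
may change with the action of buyer `i`; `observed` accounts for this. -/
def Mechanism.IsDSIC {n : ℕ} (M : Mechanism n) (vbar : ℝ) (G : Digraph (Agent n)) : Prop :=
  ∀ σ, ValidProfile vbar G σ → ∀ i, ∀ v ∈ Icc 0 vbar,
    M.utility v (observed G σ) i ≤
      M.utility v (observed G (Function.update σ i ⟨v, neighbours G (some i)⟩)) i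

/-- The joint law of the valuations, i.i.d. with density `f` on `[0, vbar]`. -/
noncomputable def profileLaw (n : ℕ) (vbar : ℝ) (f : ℝ → ℝ) : Measure (Fin n → ℝ) :=
  Measure.pi (fun _ => valueLaw vbar f)

/-- Allocation and payments under truthful behaviour are measurable in the valuations. -/
def Mechanism.IsMeasurable {n : ℕ} (M : Mechanism n) (vbar : ℝ) (f : ℝ → ℝ)
    (G : Digraph (Agent n)) : Prop :=
  ∀ i, AEMeasurable (fun v => M.alloc (observed G (truthful G v)) i) (profileLaw n vbar f) ∧
    AEMeasurable (fun v => M.pay (observed G (truthful G v)) i) (profileLaw n vbar f)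

/-- The seller's revenue on the network `G` when the valuations are `v` and buyers are truthful. -/
noncomputable def Mechanism.revenue {n : ℕ} (M : Mechanism n) (G : Digraph (Agent n)) (v : Fin n → ℝ) : ℝ :=
  ∑ i, M.pay (observed G (truthful G v)) i

/-- The seller's expected revenue on the network `G`. -/
noncomputable def Mechanism.expectedRevenue {n : ℕ} (M : Mechanism n) (vbar : ℝ) (f : ℝ → ℝ)
    (G : Digraph (Agent n)) : ℝ :=
  ∫ v, M.revenue G v ∂(profileLaw n vbar f)

/-! ### Myerson's optimal auction for i.i.d. buyers: second price with reserve price -/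

/-- Buyer `i` wins: her bid meets the reserve price `r` and is the highest one (ties are broken in
favour of the smallest index). -/
def Wins {n : ℕ} (r : ℝ) (t : Fin n → Option (Action n)) (i : Fin n) : Prop :=
  ∃ a, t i = some a ∧ r ≤ a.bid ∧
    ∀ j b, t j = some b → b.bid < a.bid ∨ (b.bid = a.bid ∧ i ≤ j)

/-- The larger one of the reserve price and the highest bid of the buyers other than `i`. -/
noncomputable def winnerPrice {n : ℕ} (r : ℝ) (t : Fin n → Option (Action n)) (i : Fin n) : ℝ :=
  sSup (insert r {x | ∃ j b, j ≠ i ∧ t j = some b ∧ b.bid = x})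

/-- The second-price auction with reserve price `r` among the participating buyers. -/
noncomputable def myersonAuction (n : ℕ) (r : ℝ) : Mechanism n where
  alloc := open Classical in fun t i => if Wins r t i then 1 else 0
  pay := open Classical in fun t i => if Wins r t i then winnerPrice r t i else 0

/-- The benchmark `OPT(N) = vbar - r F(r)^n - ∫_r^vbar [n F^(n-1) - (n-1) F^n]`. -/
noncomputable def optBenchmark (n : ℕ) (vbar : ℝ) (f : ℝ → ℝ) (r : ℝ) : ℝ :=
  vbar - r * valueCdf vbar f r ^ n -
    ∫ x in r..vbar, ((n : ℝ) * valueCdf vbar f x ^ (n - 1) -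
      ((n : ℝ) - 1) * valueCdf vbar f x ^ n)

end NetworkAuction

/-! The upper bound uses only misreports of the bid, at profiles where everybody informs all
neighbours, so the network drops out and the argument is Myerson's. Fix the bids of the others. DSIC
makes a buyer's 0/1 allocation monotone in her bid, hence almost everywhere the indicator of a
half-line above a threshold `τ`; IR and DSIC then bound her payment by `τ` if she wins and by 0
otherwise. Integration by parts shows that the price `τ` earns exactly the integral of the virtual
value over `Ici τ` (`setIntegral_Ici_virtualValue`), so her expected payment is at most her expected
virtual surplus (`integral_pay_le_virtualSurplus`, `integral_posPart_pay_le`).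

By regularity and the vanishing of the virtual value at `r`, the highest bidder above `r` maximizes
the virtual surplus pointwise (`virtualSurplus_le`). Its maximal expectation is the benchmark: a bid
`a ≥ r` wins with probability `F a ^ (n - 1)`, and integrating `x * F x ^ n` by parts gives the
closed form (`optBenchmark_eq`). The second-price auction charges each winner precisely her
threshold, so for it the payment bound is an equality (`integral_secondPrice`). -/

namespace NetworkAuction

/-! ### The law of one valuation, and integration by parts for the virtual value. -/

section OneDimensional

variable {vbar : ℝ} {f : ℝ → ℝ}

lemma ae_mem_Ioo_of_restrict (a b : ℝ) : ∀ᵐ x ∂(volume.restrict (Icc a b)), x ∈ Ioo a b := by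
  rw [← Measure.restrict_congr_set Ioo_ae_eq_Icc]
  exact ae_restrict_mem measurableSet_Ioo

lemma valueLaw_absolutelyContinuous :
    valueLaw vbar f ≪ volume.restrict (Icc 0 vbar) :=
  withDensity_absolutelyContinuous _ _

lemma ae_valueLaw_mem_Ioo : ∀ᵐ x ∂(valueLaw vbar f), x ∈ Ioo 0 vbar :=
  valueLaw_absolutelyContinuous.ae_le (ae_mem_Ioo_of_restrict 0 vbar)

instance : NullSingletonClass (valueLaw vbar f) :=
  ⟨fun x => valueLaw_absolutelyContinuous (measure_singleton x)⟩

/-- The sign of `f` is controlled only inside the open interval, but the endpoints are null, so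
`ENNReal.ofReal` loses nothing. -/
lemma setIntegral_Ici_valueLaw (hf : Measurable f) (hpos : ∀ x ∈ Ioo 0 vbar, 0 < f x)
    {τ : ℝ} (hτ : τ ∈ Icc 0 vbar) (g : ℝ → ℝ) :
    ∫ x in Ici τ, g x ∂(valueLaw vbar f) = ∫ x in τ..vbar, f x * g x := by
  rw [valueLaw, restrict_withDensity measurableSet_Ici, Measure.restrict_restrict measurableSet_Ici]
  have hs : Ici τ ∩ Icc 0 vbar = Icc τ vbar := by
    ext x
    simp only [mem_inter_iff, mem_Ici, mem_Icc]
    have := hτ.1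
    constructor
    · rintro ⟨h1, -, h2⟩; exact ⟨h1, h2⟩
    · rintro ⟨h1, h2⟩; exact ⟨h1, by linarith, h2⟩
  rw [hs, integral_withDensity_eq_integral_toReal_smul (by fun_prop) (by simp),
    intervalIntegral.integral_of_le hτ.2, ← integral_Icc_eq_integral_Ioc]
  refine integral_congr_ae ?_
  filter_upwards [ae_mem_Ioo_of_restrict τ vbar] with x hx
  rw [ENNReal.toReal_ofReal (hpos x ⟨hτ.1.trans_lt hx.1, hx.2⟩).le, smul_eq_mul]

lemma integrable_valueLaw_iff (hf : Measurable f) (hpos : ∀ x ∈ Ioo 0 vbar, 0 < f x)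
    (g : ℝ → ℝ) :
    Integrable g (valueLaw vbar f) ↔ IntegrableOn (fun x => f x * g x) (Icc 0 vbar) := by
  rw [valueLaw, integrable_withDensity_iff_integrable_smul' (by fun_prop) (by simp)]
  refine integrable_congr ?_
  filter_upwards [ae_mem_Ioo_of_restrict 0 vbar] with x hx
  rw [ENNReal.toReal_ofReal (hpos x hx).le, smul_eq_mul]

lemma valueCdf_nonneg (x : ℝ) : 0 ≤ valueCdf vbar f x := cdf_nonneg _ x

lemma valueCdf_le_one (x : ℝ) : valueCdf vbar f x ≤ 1 := cdf_le_one _ x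

lemma measurable_valueCdf : Measurable (valueCdf vbar f) := (monotone_cdf _).measurable

lemma vbar_nonneg (f : ℝ → ℝ) [IsProbabilityMeasure (valueLaw vbar f)] : 0 ≤ vbar := by
  obtain ⟨x, hx⟩ := (ae_valueLaw_mem_Ioo (vbar := vbar) (f := f)).exists
  exact (hx.1.trans hx.2).le

variable [IsProbabilityMeasure (valueLaw vbar f)]

lemma intervalIntegrable_density (hf : Measurable f) (hpos : ∀ x ∈ Ioo 0 vbar, 0 < f x) :
    IntervalIntegrable f volume 0 vbar := by
  have h := (integrable_valueLaw_iff (vbar := vbar) hf hpos (fun _ => 1)).1 (integrable_const _)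
  rw [intervalIntegrable_iff_integrableOn_Icc_of_le (vbar_nonneg f)]
  simpa using h

lemma intervalIntegrable_density_of_mem (hf : Measurable f)
    (hpos : ∀ x ∈ Ioo 0 vbar, 0 < f x) {τ : ℝ} (hτ : τ ∈ Icc 0 vbar) :
    IntervalIntegrable f volume τ vbar :=
  (intervalIntegrable_density hf hpos).mono_set <| by
    rw [uIcc_of_le hτ.2, uIcc_of_le (vbar_nonneg f)]
    exact Icc_subset_Icc_left hτ.1

lemma valueCdf_eq_real (x : ℝ) : valueCdf vbar f x = (valueLaw vbar f).real (Iic x) :=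
  cdf_eq_real _ x

lemma one_sub_valueCdf (x : ℝ) : 1 - valueCdf vbar f x = (valueLaw vbar f).real (Ici x) := by
  rw [valueCdf_eq_real, measureReal_congr Iio_ae_eq_Iic.symm, ← compl_Iio,
    probReal_compl_eq_one_sub measurableSet_Iio]

/-- Basing the integral at `vbar` builds in the normalization `F vbar = 1`. -/
lemma valueCdf_eq_integral (hf : Measurable f) (hpos : ∀ x ∈ Ioo 0 vbar, 0 < f x)
    {x : ℝ} (hx : x ∈ Icc 0 vbar) :
    valueCdf vbar f x = 1 + ∫ t in vbar..x, f t := by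
  have h := setIntegral_Ici_valueLaw hf hpos hx (fun _ => 1)
  rw [intervalIntegral.integral_symm]
  have h1 := one_sub_valueCdf (vbar := vbar) (f := f) x
  simp only [mul_one, integral_const, smul_eq_mul, measureReal_restrict_apply_univ] at h
  linarith

/-- The quotient by `f` may be unbounded, but integrating against the density cancels `f` and leaves
`1 - F`, which lies in `[0, 1]`. -/
lemma integrable_virtualValue (hf : Measurable f) (hpos : ∀ x ∈ Ioo 0 vbar, 0 < f x) :
    Integrable (virtualValue vbar f) (valueLaw vbar f) := by
  have hF := measurable_valueCdf (vbar := vbar) (f := f)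
  refine Integrable.sub (Integrable.of_mem_Icc 0 vbar aemeasurable_id ?_) ?_
  · filter_upwards [ae_valueLaw_mem_Ioo] with x hx using Ioo_subset_Icc_self hx
  · rw [integrable_valueLaw_iff hf hpos]
    refine Integrable.of_mem_Icc 0 1 (by fun_prop) ?_
    filter_upwards [ae_mem_Ioo_of_restrict 0 vbar] with x hx
    rw [mul_div_cancel₀ _ (hpos x hx).ne']
    have := valueCdf_nonneg (vbar := vbar) (f := f) x
    have := valueCdf_le_one (vbar := vbar) (f := f) x
    constructor <;> linarith

/-- The revenue benchmark is the expected virtual value of the highest of `n` buyers on the event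
that her valuation exceeds the reserve price. -/
lemma optBenchmark_eq (hf : Measurable f) (hpos : ∀ x ∈ Ioo 0 vbar, 0 < f x) (n : ℕ)
    {τ : ℝ} (hτ : τ ∈ Icc 0 vbar) :
    optBenchmark n vbar f τ =
      n * ∫ x in Ici τ, valueCdf vbar f x ^ (n - 1) * virtualValue vbar f x ∂(valueLaw vbar f) := by
  have hsub : uIcc τ vbar ⊆ Icc 0 vbar := by
    rw [uIcc_of_le hτ.2]; exact Icc_subset_Icc_left hτ.1
  have hint := intervalIntegrable_density_of_mem hf hpos hτ
  -- `G` agrees with the cdf on the interval and is visibly absolutely continuous with a.e.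
  -- derivative `f`; no continuity of `f` is needed.
  set G : ℝ → ℝ := fun x => 1 + ∫ t in vbar..x, f t with hG
  have hFG : ∀ x ∈ uIcc τ vbar, valueCdf vbar f x = G x := fun x hx =>
    valueCdf_eq_integral hf hpos (hsub hx)
  have hGac : AbsolutelyContinuousOnInterval G τ vbar := by
    refine AbsolutelyContinuousOnInterval.fun_add ?_ ?_
    · exact contDiffOn_const.absolutelyContinuousOnInterval
    · exact hint.absolutelyContinuousOnInterval_intervalIntegral (by simp)
  have hGd : ∀ᵐ x, x ∈ uIcc τ vbar → HasDerivAt G (f x) x := by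
    filter_upwards [hint.ae_hasDerivAt_integral] with x hx hx'
    exact (hx hx' vbar (by simp)).const_add 1
  have hGpow : ∀ k : ℕ, AbsolutelyContinuousOnInterval (fun x => G x ^ k) τ vbar := by
    intro k
    induction k with
    | zero => simpa using contDiffOn_const.absolutelyContinuousOnInterval
    | succ k ih => simpa only [pow_succ] using ih.fun_mul hGac
  have hcont : ∀ k : ℕ, ContinuousOn (fun x => G x ^ k) (uIcc τ vbar) := fun k =>
    (hGpow k).continuousOn
  have hid : AbsolutelyContinuousOnInterval (fun x : ℝ => x) τ vbar :=
    contDiffOn_id.absolutelyContinuousOnInterval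
  have hparts := (hGpow n).integral_deriv_mul_eq_sub hid
  have hGv : G vbar = 1 := by simp [hG]
  have hparts' : ∫ x in τ..vbar, (n * G x ^ (n - 1) * f x * x + G x ^ n) =
      vbar - τ * G τ ^ n := by
    have : vbar - τ * G τ ^ n = G vbar ^ n * vbar - G τ ^ n * τ := by rw [hGv]; ring
    rw [this, ← hparts]
    refine intervalIntegral.integral_congr_ae ?_
    filter_upwards [hGd] with x hx hx'
    rw [((hx (uIoc_subset_uIcc hx')).fun_pow n).deriv]
    simp
  have hc := hcont (n - 1)
  have hi1 : IntervalIntegrable (fun x => n * G x ^ (n - 1) * f x * x + G x ^ n) volume τ vbar := by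
    refine IntervalIntegrable.add ?_ (hcont n).intervalIntegrable
    refine IntervalIntegrable.mul_continuousOn ?_ continuousOn_id
    exact hint.continuousOn_mul (continuousOn_const.mul hc)
  have hi2 : IntervalIntegrable (fun x => n * G x ^ (n - 1) - ((n : ℝ) - 1) * G x ^ n)
      volume τ vbar :=
    ((continuousOn_const.mul hc).sub (continuousOn_const.mul (hcont n))).intervalIntegrable
  rw [setIntegral_Ici_valueLaw hf hpos hτ, ← intervalIntegral.integral_const_mul, optBenchmark,
    hFG τ (by simp), ← hparts']
  rw [intervalIntegral.integral_congr (f := fun x => n * valueCdf vbar f x ^ (n - 1) -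
      ((n : ℝ) - 1) * valueCdf vbar f x ^ n)
    (g := fun x => n * G x ^ (n - 1) - ((n : ℝ) - 1) * G x ^ n)
    (fun x hx => by simp only [hFG x hx]), ← intervalIntegral.integral_sub hi1 hi2]
  refine intervalIntegral.integral_congr_ae ?_
  -- Dividing by `f x` needs `f x > 0`, which may fail at the endpoint.
  have hne : ∀ᵐ x : ℝ, x ≠ vbar := by simp [ae_iff]
  filter_upwards [hne] with x hxv hx
  have hx' := uIoc_subset_uIcc hx
  rw [uIoc_of_le hτ.2] at hx
  have hfx := hpos x ⟨hτ.1.trans_lt hx.1, lt_of_le_of_ne hx.2 hxv⟩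
  rw [virtualValue, hFG x hx']
  -- The truncated exponent `n - 1` makes `n = 0` a separate case.
  rcases n with _ | n
  · simp
  · simp only [Nat.add_sub_cancel]
    field_simp
    push_cast
    ring

/-- This is the one-buyer benchmark, where the integrand in `optBenchmark` is constantly 1. -/
lemma setIntegral_Ici_virtualValue (hf : Measurable f) (hpos : ∀ x ∈ Ioo 0 vbar, 0 < f x)
    {τ : ℝ} (hτ : τ ∈ Icc 0 vbar) :
    ∫ x in Ici τ, virtualValue vbar f x ∂(valueLaw vbar f) =
      τ * (valueLaw vbar f).real (Ici τ) := by
  have h := optBenchmark_eq hf hpos 1 hτ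
  rw [← one_sub_valueCdf]
  simp [optBenchmark] at h
  linarith

end OneDimensional

/-! ### One buyer with the others fixed: thresholds and payments. -/

section Threshold

variable {vbar : ℝ} {f : ℝ → ℝ} [IsProbabilityMeasure (valueLaw vbar f)]

lemma integral_mul_virtualValue_of_threshold (hf : Measurable f)
    (hpos : ∀ x ∈ Ioo 0 vbar, 0 < f x) {τ : ℝ} (hτ : τ ∈ Icc 0 vbar) {x : ℝ → ℝ}
    (hx : x =ᵐ[valueLaw vbar f] (Ici τ).indicator 1) :
    ∫ v, x v * virtualValue vbar f v ∂(valueLaw vbar f) = ∫ v, x v * τ ∂(valueLaw vbar f) := by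
  have h (g : ℝ → ℝ) : ∫ v, x v * g v ∂(valueLaw vbar f) =
      ∫ v in Ici τ, g v ∂(valueLaw vbar f) := by
    rw [← integral_indicator measurableSet_Ici]
    refine integral_congr_ae ?_
    filter_upwards [hx] with v hv
    rw [hv]
    by_cases h : v ∈ Ici τ <;> simp [h]
  rw [h, h, setIntegral_Ici_virtualValue hf hpos hτ]
  simp [mul_comm]

/-- A payment rule supporting a monotone allocation rule extracts at most the virtual surplus. -/
lemma integral_pay_le_virtualSurplus (hf : Measurable f) (hpos : ∀ x ∈ Ioo 0 vbar, 0 < f x)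
    {x q : ℝ → ℝ} (hx : ∀ v ∈ Icc 0 vbar, x v = 0 ∨ x v = 1)
    (hmono : ∀ v ∈ Icc 0 vbar, ∀ w ∈ Icc 0 vbar, v ≤ w → x v = 1 → x w = 1)
    (hq0 : ∀ v ∈ Icc 0 vbar, x v = 0 → q v ≤ 0)
    (hq1 : ∀ v ∈ Icc 0 vbar, ∀ w ∈ Icc 0 vbar, x v = 1 → x w = 1 → q v ≤ w)
    (hq : Integrable q (valueLaw vbar f)) :
    ∫ v, q v ∂(valueLaw vbar f) ≤ ∫ v, x v * virtualValue vbar f v ∂(valueLaw vbar f) := by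
  have key : ∃ τ ∈ Icc 0 vbar, x =ᵐ[valueLaw vbar f] (Ici τ).indicator 1 ∧
      ∀ v ∈ Icc 0 vbar, q v ≤ x v * τ := by
    rcases Set.eq_empty_or_nonempty {v ∈ Icc 0 vbar | x v = 1} with hS | hS
    · have h0 : ∀ v ∈ Icc 0 vbar, x v = 0 := fun v hv =>
        (hx v hv).resolve_right fun h1 => by
          have : v ∈ {v ∈ Icc 0 vbar | x v = 1} := ⟨hv, h1⟩
          rw [hS] at this
          exact this
      -- If no bid wins, `vbar` serves as threshold, since `Ici vbar` is null.
      refine ⟨vbar, right_mem_Icc.2 (vbar_nonneg f), ?_, fun v hv => ?_⟩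
      · filter_upwards [ae_valueLaw_mem_Ioo] with v hv
        rw [h0 v (Ioo_subset_Icc_self hv), indicator_of_notMem (by simpa using hv.2)]
      · rw [h0 v hv, zero_mul]
        exact hq0 v hv (h0 v hv)
    · set S := {v ∈ Icc 0 vbar | x v = 1} with hSdef
      have hbdd : BddBelow S := ⟨0, fun v hv => hv.1.1⟩
      have hle : ∀ v ∈ S, sInf S ≤ v := fun v hv => csInf_le hbdd hv
      have hτ : sInf S ∈ Icc 0 vbar := by
        refine ⟨le_csInf hS fun v hv => hv.1.1, ?_⟩
        obtain ⟨v, hv⟩ := hS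
        exact (hle v hv).trans hv.1.2
      refine ⟨sInf S, hτ, ?_, fun v hv => ?_⟩
      -- A bid equal to the infimum may win or lose; it is discarded because the law has no atoms.
      · filter_upwards [ae_valueLaw_mem_Ioo, Measure.ae_ne (valueLaw vbar f) (sInf S)]
          with v hv hne
        have hv' := Ioo_subset_Icc_self hv
        by_cases hlt : sInf S ≤ v
        · obtain ⟨w, hw, hwv⟩ := exists_lt_of_csInf_lt hS (lt_of_le_of_ne hlt hne.symm)
          rw [hmono w hw.1 v hv' hwv.le hw.2, indicator_of_mem (show v ∈ Ici (sInf S) from hlt)]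
          rfl
        · rw [indicator_of_notMem (show v ∉ Ici (sInf S) from hlt)]
          exact (hx v hv').resolve_right fun h1 => hlt (hle v ⟨hv', h1⟩)
      · rcases hx v hv with h | h
        · rw [h, zero_mul]; exact hq0 v hv h
        · rw [h, one_mul]; exact le_csInf hS fun w hw => hq1 v hv w hw.1 h hw.2
  obtain ⟨τ, hτ, hxτ, hqτ⟩ := key
  rw [integral_mul_virtualValue_of_threshold hf hpos hτ hxτ]
  refine integral_mono_ae hq ?_ ?_
  · have : Integrable ((Ici τ).indicator (1 : ℝ → ℝ)) (valueLaw vbar f) :=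
      (integrable_const (1 : ℝ)).indicator measurableSet_Ici
    exact (this.congr hxτ.symm).mul_const τ
  · filter_upwards [ae_valueLaw_mem_Ioo] with v hv using hqτ v (Ioo_subset_Icc_self hv)

end Threshold

/-! ### Conditioning on the other coordinates by redrawing one of them. -/

section Resampling

variable {ι : Type*} [Fintype ι] [DecidableEq ι] {μ : Measure ℝ} [IsProbabilityMeasure μ]

/-- Resampling one coordinate of an i.i.d. family does not change its law. -/
lemma measurePreserving_update (i : ι) :
    MeasurePreserving (fun p : (ι → ℝ) × ℝ => Function.update p.1 i p.2)
      ((Measure.pi fun _ : ι => μ).prod μ) (Measure.pi fun _ => μ) := by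
  have hm : Measurable (fun p : (ι → ℝ) × ℝ => Function.update p.1 i p.2) := by
    refine measurable_pi_lambda _ fun j => ?_
    by_cases h : j = i
    · subst h; simpa using measurable_snd
    · simp only [Function.update_of_ne h]; fun_prop
  refine ⟨hm, (Measure.pi_eq fun s hs => ?_).symm⟩
  rw [Measure.map_apply hm (MeasurableSet.univ_pi hs)]
  -- The old `i`-th coordinate is overwritten, hence unconstrained, and its factor has mass 1.
  have : (fun p : (ι → ℝ) × ℝ => Function.update p.1 i p.2) ⁻¹' univ.pi s =
      (univ.pi (Function.update s i univ)) ×ˢ s i := by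
    ext ⟨v, a⟩
    simp only [mem_preimage, mem_univ_pi, mem_prod]
    constructor
    · intro h
      refine ⟨fun j => ?_, by simpa using h i⟩
      by_cases hj : j = i
      · subst hj; simp
      · simpa [hj] using h j
    · rintro ⟨h, ha⟩ j
      by_cases hj : j = i
      · subst hj; simpa using ha
      · simpa [hj] using h j
  rw [this, Measure.prod_prod, Measure.pi_pi,
    ← Finset.prod_erase_mul _ _ (Finset.mem_univ i),
    ← Finset.prod_erase_mul (a := i) _ _ (Finset.mem_univ i)]
  simp only [Function.update_self, measure_univ, mul_one]
  congr 1
  refine Finset.prod_congr rfl fun j hj => ?_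
  rw [Function.update_of_ne (Finset.ne_of_mem_erase hj)]

variable {g h : (ι → ℝ) → ℝ}

lemma integrable_update (hg : Integrable g (Measure.pi fun _ : ι => μ)) (i : ι) :
    Integrable (fun p : (ι → ℝ) × ℝ => g (Function.update p.1 i p.2))
      ((Measure.pi fun _ : ι => μ).prod μ) :=
  (measurePreserving_update i).integrable_comp_of_integrable hg

lemma integral_eq_integral_update (hg : Integrable g (Measure.pi fun _ : ι => μ)) (i : ι) :
    ∫ v, g v ∂(Measure.pi fun _ : ι => μ) =
      ∫ v, ∫ a, g (Function.update v i a) ∂μ ∂(Measure.pi fun _ : ι => μ) := by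
  have hp := measurePreserving_update (μ := μ) i
  rw [← integral_prod _ (integrable_update hg i)]
  conv_lhs => rw [← hp.map_eq]
  exact integral_map hp.aemeasurable (by rw [hp.map_eq]; exact hg.1)

lemma integral_eq_integral_update_swap (hg : Integrable g (Measure.pi fun _ : ι => μ)) (i : ι) :
    ∫ v, g v ∂(Measure.pi fun _ : ι => μ) =
      ∫ a, ∫ v, g (Function.update v i a) ∂(Measure.pi fun _ : ι => μ) ∂μ := by
  rw [integral_eq_integral_update hg i]
  exact integral_integral_swap (integrable_update hg i)

/-- By Fubini it suffices to compare slices; almost every slice of `g` is integrable, so this may be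
assumed there. -/
lemma integral_mono_update (i : ι) (hg : Integrable g (Measure.pi fun _ : ι => μ))
    (hh : Integrable h (Measure.pi fun _ : ι => μ))
    (hle : ∀ᵐ v ∂(Measure.pi fun _ : ι => μ), Integrable (fun a => g (Function.update v i a)) μ →
      ∫ a, g (Function.update v i a) ∂μ ≤ ∫ a, h (Function.update v i a) ∂μ) :
    ∫ v, g v ∂(Measure.pi fun _ : ι => μ) ≤ ∫ v, h v ∂(Measure.pi fun _ : ι => μ) := by
  rw [integral_eq_integral_update hg i, integral_eq_integral_update hh i]
  refine integral_mono_ae (integrable_update hg i).integral_prod_left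
    (integrable_update hh i).integral_prod_left ?_
  filter_upwards [hle, (integrable_update hg i).prod_right_ae] with v hv hi using hv hi

end Resampling

/-! ### The joint law of the valuations. -/

section Profiles

variable {n : ℕ} {vbar : ℝ} {f : ℝ → ℝ} [IsProbabilityMeasure (valueLaw vbar f)]

instance : IsProbabilityMeasure (profileLaw n vbar f) := by
  unfold profileLaw; infer_instance

lemma ae_profileLaw_mem_Ioo : ∀ᵐ v ∂(profileLaw n vbar f), ∀ i, v i ∈ Ioo 0 vbar := by
  rw [Filter.eventually_all]
  intro i
  exact (measurePreserving_eval (fun _ : Fin n => valueLaw vbar f) i).quasiMeasurePreserving.ae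
    ae_valueLaw_mem_Ioo

lemma integrable_mul_virtualValue (hf : Measurable f) (hpos : ∀ x ∈ Ioo 0 vbar, 0 < f x)
    (i : Fin n) {x : (Fin n → ℝ) → ℝ} (hx : AEMeasurable x (profileLaw n vbar f))
    (hx1 : ∀ᵐ v ∂(profileLaw n vbar f), x v = 0 ∨ x v = 1) :
    Integrable (fun v => x v * virtualValue vbar f (v i)) (profileLaw n vbar f) := by
  refine Integrable.bdd_mul (c := 1) ?_ hx.aestronglyMeasurable ?_
  · exact (measurePreserving_eval (fun _ : Fin n => valueLaw vbar f)
      i).integrable_comp_of_integrable (integrable_virtualValue hf hpos)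
  · filter_upwards [hx1] with v hv
    rcases hv with h | h <;> simp [h]

end Profiles

/-! ### Payments of an arbitrary mechanism on an arbitrary network. -/

section UpperBound

variable {n : ℕ} {vbar : ℝ} {f : ℝ → ℝ} {G : Digraph (Agent n)} {M : Mechanism n}

lemma validProfile_truthful {v : Fin n → ℝ} (hv : ∀ i, v i ∈ Icc 0 vbar) :
    ValidProfile vbar G (truthful G v) :=
  fun i => ⟨hv i, subset_rfl⟩

lemma truthful_update (v : Fin n → ℝ) (i : Fin n) (a : ℝ) :
    truthful G (Function.update v i a) =
      Function.update (truthful G v) i ⟨a, neighbours G (some i)⟩ := by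
  funext j
  by_cases h : j = i
  · subst h; simp [truthful]
  · simp [truthful, h]

lemma update_mem_Icc {v : Fin n → ℝ} (hv : ∀ i, v i ∈ Icc 0 vbar) (i : Fin n) {a : ℝ}
    (ha : a ∈ Icc 0 vbar) (j : Fin n) : Function.update v i a j ∈ Icc 0 vbar := by
  by_cases h : j = i
  · subst h; simpa using ha
  · simpa [h] using hv j

/-- The bid of a buyer cannot be profitably misreported when everybody informs all neighbours. -/
lemma Mechanism.IsDSIC.le_update (hD : M.IsDSIC vbar G) {v : Fin n → ℝ}
    (hv : ∀ i, v i ∈ Icc 0 vbar) (i : Fin n) {a b : ℝ} (ha : a ∈ Icc 0 vbar)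
    (hb : b ∈ Icc 0 vbar) :
    M.alloc (observed G (truthful G (Function.update v i a))) i * b -
        M.pay (observed G (truthful G (Function.update v i a))) i ≤
      M.alloc (observed G (truthful G (Function.update v i b))) i * b -
        M.pay (observed G (truthful G (Function.update v i b))) i := by
  have h := hD _ (validProfile_truthful (G := G) (update_mem_Icc hv i ha)) i b hb
  rw [← truthful_update, Function.update_idem] at h
  exact h

lemma Mechanism.IsIR.pay_le (hI : M.IsIR vbar G) {v : Fin n → ℝ}
    (hv : ∀ i, v i ∈ Icc 0 vbar) (i : Fin n) :
    M.pay (observed G (truthful G v)) i ≤ M.alloc (observed G (truthful G v)) i * v i := by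
  have h := hI _ (validProfile_truthful (G := G) hv) i
  change 0 ≤ _ * v i - _ at h
  linarith

variable [IsProbabilityMeasure (valueLaw vbar f)]

/-- IR bounds payments above by `vbar`, but subsidies may be arbitrarily large; passing to the
positive part secures integrability and only strengthens the bound. -/
lemma integrable_posPart_pay (hF : M.IsFeasible vbar G) (hI : M.IsIR vbar G)
    (hM : M.IsMeasurable vbar f G) (i : Fin n) :
    Integrable (fun v => max (M.pay (observed G (truthful G v)) i) 0) (profileLaw n vbar f) := by
  refine Integrable.of_mem_Icc 0 vbar ((hM i).2.max aemeasurable_const) ?_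
  filter_upwards [ae_profileLaw_mem_Ioo] with v hv
  have hv' := fun j => Ioo_subset_Icc_self (hv j)
  refine ⟨le_max_right _ _, max_le ((hI.pay_le hv' i).trans ?_) (vbar_nonneg f)⟩
  have := hv' i
  rcases (hF _ (validProfile_truthful hv')).1 i with h | h <;> rw [h] <;>
    linarith [this.1, this.2]

/-- On any network the expected payment of a buyer is at most her expected virtual surplus. -/
lemma integral_posPart_pay_le (hf : Measurable f) (hpos : ∀ x ∈ Ioo 0 vbar, 0 < f x)
    (hF : M.IsFeasible vbar G) (hI : M.IsIR vbar G) (hD : M.IsDSIC vbar G)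
    (hM : M.IsMeasurable vbar f G) (i : Fin n) :
    ∫ v, max (M.pay (observed G (truthful G v)) i) 0 ∂(profileLaw n vbar f) ≤
      ∫ v, M.alloc (observed G (truthful G v)) i * virtualValue vbar f (v i)
        ∂(profileLaw n vbar f) := by
  have hx01 : ∀ v : Fin n → ℝ, (∀ i, v i ∈ Icc 0 vbar) →
      M.alloc (observed G (truthful G v)) i = 0 ∨ M.alloc (observed G (truthful G v)) i = 1 :=
    fun v hv => (hF _ (validProfile_truthful hv)).1 i
  refine integral_mono_update i (integrable_posPart_pay hF hI hM i) ?_ ?_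
  · refine integrable_mul_virtualValue hf hpos i (hM i).1 ?_
    filter_upwards [ae_profileLaw_mem_Ioo] with v hv
      using hx01 v fun j => Ioo_subset_Icc_self (hv j)
  · filter_upwards [ae_profileLaw_mem_Ioo] with v hv hi
    have hv' := fun j => Ioo_subset_Icc_self (hv j)
    have hp : ∀ a ∈ Icc 0 vbar, M.pay (observed G (truthful G (Function.update v i a))) i ≤
        M.alloc (observed G (truthful G (Function.update v i a))) i * a := fun a ha => by
      simpa using hI.pay_le (update_mem_Icc hv' i ha) i
    simp only [Function.update_self]
    refine integral_pay_le_virtualSurplus hf hpos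
      (x := fun a => M.alloc (observed G (truthful G (Function.update v i a))) i)
      (fun a ha => hx01 _ (update_mem_Icc hv' i ha)) ?_ ?_ ?_ hi
    -- If `a` won and a larger `b` lost, adding the two incentive constraints would give `b ≤ a`.
    · intro a ha b hb hab h1
      refine (hx01 _ (update_mem_Icc hv' i hb)).resolve_left fun h0 => ?_
      have e1 := hD.le_update hv' i ha hb
      have e2 := hD.le_update hv' i hb ha
      rcases eq_or_lt_of_le hab with rfl | hlt
      · linarith
      · rw [h0, h1] at e1 e2
        linarith
    · intro a ha h0
      have := hp a ha
      rw [h0, zero_mul] at this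
      exact max_le this le_rfl
    -- By DSIC two winning bids pay the same, and IR bounds the payment at `b` by `b`.
    · intro a ha b hb h1 h2
      have e1 := hD.le_update hv' i hb ha
      have e2 := hD.le_update hv' i ha hb
      have e3 := hp b hb
      rw [h1, h2] at e1 e2
      rw [h2] at e3
      exact max_le (by linarith) hb.1

end UpperBound

/-! ### The second-price auction in terms of bids. -/

section SecondPrice

variable {n : ℕ} {r : ℝ}

/-- Buyer `i` has the highest bid (ties favour the smallest index), and it meets the reserve. -/
def IsWinner (r : ℝ) (b : Fin n → ℝ) (i : Fin n) : Prop :=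
  r ≤ b i ∧ ∀ j, b j < b i ∨ (b j = b i ∧ i ≤ j)

open Classical in
/-- The allocation of the second-price auction as a function of the bids. -/
noncomputable def winnerIndicator (r : ℝ) (b : Fin n → ℝ) (i : Fin n) : ℝ :=
  if IsWinner r b i then 1 else 0

/-- The larger one of the reserve price and the highest competing bid. -/
noncomputable def competingBid (r : ℝ) (b : Fin n → ℝ) (i : Fin n) : ℝ :=
  ⨆ j, Function.update b i r j

lemma winnerIndicator_eq_zero_or_one (b : Fin n → ℝ) (i : Fin n) :
    winnerIndicator r b i = 0 ∨ winnerIndicator r b i = 1 := by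
  unfold winnerIndicator; split_ifs <;> simp

lemma IsWinner.unique {b : Fin n → ℝ} {i k : Fin n} (hi : IsWinner r b i)
    (hk : IsWinner r b k) : i = k := by
  rcases hi.2 k with h | ⟨h, h'⟩ <;> rcases hk.2 i with e | ⟨e, e'⟩
  · linarith
  · linarith
  · linarith
  · exact le_antisymm h' e'

lemma IsWinner.sum_winnerIndicator_mul {b : Fin n → ℝ} {i : Fin n} (hi : IsWinner r b i)
    (g : Fin n → ℝ) : ∑ k, winnerIndicator r b k * g k = g i := by
  rw [Finset.sum_eq_single i]
  · simp [winnerIndicator, hi]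
  · intro k _ hk
    rw [winnerIndicator, if_neg fun h => hk (h.unique hi), zero_mul]
  · simp

lemma sum_winnerIndicator_le_one (b : Fin n → ℝ) : ∑ i, winnerIndicator r b i ≤ 1 := by
  by_cases h : ∃ i, IsWinner r b i
  · obtain ⟨i, hi⟩ := h
    simpa using (hi.sum_winnerIndicator_mul fun _ => 1).le
  · push Not at h
    simp [winnerIndicator, h]

lemma exists_isWinner {b : Fin n → ℝ} {i : Fin n} (hi : r ≤ b i) : ∃ k, IsWinner r b k := by
  -- The lexicographic order on bid and reversed index encodes the tie-breaking rule.
  obtain ⟨k, -, hk⟩ := Finset.exists_max_image Finset.univ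
    (fun j => toLex (b j, OrderDual.toDual j)) ⟨i, Finset.mem_univ i⟩
  have hk' : ∀ j, b j < b k ∨ (b j = b k ∧ k ≤ j) := fun j => by
    simpa [Prod.Lex.toLex_le_toLex] using hk j (Finset.mem_univ j)
  refine ⟨k, ?_, hk'⟩
  rcases hk' i with h | ⟨h, -⟩ <;> linarith

lemma le_competingBid_reserve (b : Fin n → ℝ) (i : Fin n) : r ≤ competingBid r b i := by
  simpa [competingBid] using le_ciSup (Finite.bddAbove_range (Function.update b i r)) i

lemma le_competingBid (b : Fin n → ℝ) {i j : Fin n} (h : j ≠ i) : b j ≤ competingBid r b i := by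
  simpa [competingBid, h] using le_ciSup (Finite.bddAbove_range (Function.update b i r)) j

lemma competingBid_le {b : Fin n → ℝ} {i : Fin n} {c : ℝ} (hr : r ≤ c)
    (h : ∀ j, j ≠ i → b j ≤ c) : competingBid r b i ≤ c := by
  have : Nonempty (Fin n) := ⟨i⟩
  refine ciSup_le fun j => ?_
  by_cases hj : j = i
  · subst hj; simpa using hr
  · simpa [hj] using h j hj

/-- The buyer's own bid is overwritten by the reserve, so she cannot influence the price she faces;
truthfulness rests on this. -/
lemma competingBid_update (b : Fin n → ℝ) (i : Fin n) (a : ℝ) :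
    competingBid r (Function.update b i a) i = competingBid r b i := by
  simp [competingBid]

lemma IsWinner.competingBid_le {b : Fin n → ℝ} {i : Fin n} (h : IsWinner r b i) :
    competingBid r b i ≤ b i := by
  refine NetworkAuction.competingBid_le h.1 fun j _ => ?_
  rcases h.2 j with h | h
  · exact h.le
  · exact h.1.le

/-- With `IsWinner.competingBid_le`, this makes the competing bid the winning threshold, up to the
tie case. -/
lemma isWinner_of_competingBid_lt {b : Fin n → ℝ} {i : Fin n} (h : competingBid r b i < b i) :
    IsWinner r b i := by
  refine ⟨(le_competingBid_reserve b i).trans h.le, fun j => ?_⟩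
  by_cases hj : j = i
  · subst hj; simp
  · exact Or.inl ((le_competingBid b hj).trans_lt h)

/-- Bidding her valuation is a dominant strategy in the second-price auction. -/
lemma secondPrice_truthful (b : Fin n → ℝ) (i : Fin n) (v : ℝ) :
    winnerIndicator r b i * v - winnerIndicator r b i * competingBid r b i ≤
      winnerIndicator r (Function.update b i v) i * v -
        winnerIndicator r (Function.update b i v) i * competingBid r (Function.update b i v) i := by
  rw [competingBid_update]
  by_cases h : IsWinner r (Function.update b i v) i
  · have hle := h.competingBid_le
    rw [competingBid_update, Function.update_self] at hle
    rw [winnerIndicator, winnerIndicator, if_pos h]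
    split_ifs <;> linarith
  · have hle : v ≤ competingBid r b i := by
      by_contra! hlt
      exact h (isWinner_of_competingBid_lt (by simpa [competingBid_update] using hlt))
    rw [winnerIndicator, winnerIndicator, if_neg h]
    split_ifs <;> linarith

lemma secondPrice_nonneg (b : Fin n → ℝ) (i : Fin n) :
    0 ≤ winnerIndicator r b i * b i - winnerIndicator r b i * competingBid r b i := by
  rw [winnerIndicator]
  split_ifs with h
  · linarith [h.competingBid_le]
  · simp

lemma measurableSet_isWinner (i : Fin n) : MeasurableSet {b : Fin n → ℝ | IsWinner r b i} := by
  have : {b : Fin n → ℝ | IsWinner r b i} =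
      {b | r ≤ b i} ∩ ⋂ j, ({b | b j < b i} ∪ ({b | b j = b i} ∩ {_b | i ≤ j})) := by
    ext b; simp [IsWinner]
  rw [this]
  refine (measurableSet_le (by fun_prop) (by fun_prop)).inter (MeasurableSet.iInter fun j => ?_)
  exact (measurableSet_lt (by fun_prop) (by fun_prop)).union
    ((measurableSet_eq_fun (by fun_prop) (by fun_prop)).inter (MeasurableSet.const _))

lemma measurable_winnerIndicator (i : Fin n) :
    Measurable fun b : Fin n → ℝ => winnerIndicator r b i := by
  unfold winnerIndicator
  exact Measurable.ite (measurableSet_isWinner i) measurable_const measurable_const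

lemma measurable_competingBid (i : Fin n) :
    Measurable fun b : Fin n → ℝ => competingBid r b i := by
  unfold competingBid
  refine Measurable.iSup fun j => ?_
  by_cases hj : j = i
  · subst hj; simp
  · simp only [Function.update_of_ne hj]; fun_prop

lemma wins_iff_isWinner (σ : Fin n → Action n) (i : Fin n) :
    Wins r (fun j => some (σ j)) i ↔ IsWinner r (fun j => (σ j).bid) i := by
  simp [Wins, IsWinner]

lemma winnerPrice_eq_competingBid (σ : Fin n → Action n) (i : Fin n) :
    winnerPrice r (fun j => some (σ j)) i = competingBid r (fun j => (σ j).bid) i := by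
  rw [winnerPrice, competingBid, iSup]
  congr 1
  ext x
  simp only [mem_insert_iff, mem_ofPred_eq, Option.some.injEq, mem_range]
  constructor
  · rintro (rfl | ⟨j, b, hj, rfl, rfl⟩)
    · exact ⟨i, by simp⟩
    · exact ⟨j, by simp [hj]⟩
  · rintro ⟨j, rfl⟩
    by_cases hj : j = i
    · subst hj; simp
    · exact Or.inr ⟨j, _, hj, rfl, by simp [hj]⟩

lemma myersonAuction_alloc (σ : Fin n → Action n) (i : Fin n) :
    (myersonAuction n r).alloc (fun j => some (σ j)) i =
      winnerIndicator r (fun j => (σ j).bid) i := by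
  have h := wins_iff_isWinner (r := r) σ i
  by_cases hw : IsWinner r (fun j => (σ j).bid) i <;>
    simp [myersonAuction, winnerIndicator, h, hw]

lemma myersonAuction_pay (σ : Fin n → Action n) (i : Fin n) :
    (myersonAuction n r).pay (fun j => some (σ j)) i =
      winnerIndicator r (fun j => (σ j).bid) i * competingBid r (fun j => (σ j).bid) i := by
  have h := wins_iff_isWinner (r := r) σ i
  by_cases hw : IsWinner r (fun j => (σ j).bid) i <;>
    simp [myersonAuction, winnerIndicator, h, hw, winnerPrice_eq_competingBid]

/-! ### The auction on a network where the seller reaches everybody, and its optimality. -/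

variable {vbar : ℝ} {f : ℝ → ℝ} {G : Digraph (Agent n)}

/-- The seller's own announcement suffices, so withholding information excludes nobody. -/
lemma observed_eq_some (hG : ∀ i : Fin n, some i ∈ neighbours G none) (σ : Fin n → Action n) :
    observed G σ = fun j => some (σ j) := by
  funext j
  exact if_pos (Informed.seller (hG j))

lemma myersonAuction_isFeasible (hG : ∀ i : Fin n, some i ∈ neighbours G none) :
    (myersonAuction n r).IsFeasible vbar G := by
  intro σ _
  rw [observed_eq_some hG]
  simp only [myersonAuction_alloc]
  exact ⟨winnerIndicator_eq_zero_or_one _, sum_winnerIndicator_le_one _, by simp⟩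

lemma myersonAuction_isIR (hG : ∀ i : Fin n, some i ∈ neighbours G none) :
    (myersonAuction n r).IsIR vbar G := by
  intro σ _ i
  rw [observed_eq_some hG, Mechanism.utility, myersonAuction_alloc, myersonAuction_pay]
  exact secondPrice_nonneg _ i

lemma myersonAuction_isDSIC (hG : ∀ i : Fin n, some i ∈ neighbours G none) :
    (myersonAuction n r).IsDSIC vbar G := by
  intro σ _ i v _
  simp only [observed_eq_some hG, Mechanism.utility, myersonAuction_alloc, myersonAuction_pay]
  have : (fun j => (Function.update σ i ⟨v, neighbours G (some i)⟩ j).bid) =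
      Function.update (fun j => (σ j).bid) i v := by
    funext j
    by_cases h : j = i
    · subst h; simp
    · simp [h]
  rw [this]
  exact secondPrice_truthful _ i v

lemma myersonAuction_isMeasurable (hG : ∀ i : Fin n, some i ∈ neighbours G none) :
    (myersonAuction n r).IsMeasurable vbar f G := by
  intro i
  simp only [observed_eq_some hG, myersonAuction_alloc, myersonAuction_pay, truthful]
  exact ⟨(measurable_winnerIndicator i).aemeasurable,
    ((measurable_winnerIndicator i).mul (measurable_competingBid i)).aemeasurable⟩

lemma myersonAuction_revenue (hG : ∀ i : Fin n, some i ∈ neighbours G none) :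
    (myersonAuction n r).revenue G =
      fun v => ∑ i, winnerIndicator r v i * competingBid r v i := by
  funext v
  simp only [Mechanism.revenue, observed_eq_some hG, myersonAuction_pay, truthful]

/-- Allocating to the highest bidder above the reserve maximizes the virtual surplus. -/
lemma virtualSurplus_le (hreg : IsRegular vbar f) (hr : r ∈ Ioo 0 vbar)
    (hr0 : virtualValue vbar f r = 0) {v x : Fin n → ℝ} (hv : ∀ i, v i ∈ Ioo 0 vbar)
    (hx0 : ∀ i, 0 ≤ x i) (hx1 : ∑ i, x i ≤ 1) :
    ∑ i, x i * virtualValue vbar f (v i) ≤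
      ∑ i, winnerIndicator r v i * virtualValue vbar f (v i) := by
  by_cases h : ∃ i, r ≤ v i
  · obtain ⟨i, hi⟩ := h
    obtain ⟨k, hk⟩ := exists_isWinner hi
    rw [hk.sum_winnerIndicator_mul]
    have hk0 : 0 ≤ virtualValue vbar f (v k) := hr0 ▸ hreg hr (hv k) hk.1
    calc ∑ j, x j * virtualValue vbar f (v j)
        ≤ ∑ j, x j * virtualValue vbar f (v k) := by
          refine Finset.sum_le_sum fun j _ => mul_le_mul_of_nonneg_left ?_ (hx0 j)
          refine hreg (hv j) (hv k) ?_
          rcases hk.2 j with h | h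
          · exact h.le
          · exact h.1.le
      _ = (∑ j, x j) * virtualValue vbar f (v k) := by rw [Finset.sum_mul]
      _ ≤ virtualValue vbar f (v k) := mul_le_of_le_one_left hk0 hx1
  · push Not at h
    have hw : ∀ i, winnerIndicator r v i = 0 := fun i => if_neg fun hi => (h i).not_ge hi.1
    simp only [hw, zero_mul, Finset.sum_const_zero]
    refine Finset.sum_nonpos fun i _ => mul_nonpos_of_nonneg_of_nonpos (hx0 i) ?_
    exact hr0 ▸ hreg (hv i) hr (h i).le

variable [IsProbabilityMeasure (valueLaw vbar f)]

lemma integrable_secondPrice (hr : r ∈ Ioo 0 vbar) (i : Fin n) :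
    Integrable (fun v : Fin n → ℝ => winnerIndicator r v i * competingBid r v i)
      (profileLaw n vbar f) := by
  refine Integrable.of_mem_Icc 0 vbar
    ((measurable_winnerIndicator i).mul (measurable_competingBid i)).aemeasurable ?_
  filter_upwards [ae_profileLaw_mem_Ioo] with v hv
  have h0 : 0 ≤ competingBid r v i := hr.1.le.trans (le_competingBid_reserve v i)
  have h1 : competingBid r v i ≤ vbar := competingBid_le hr.2.le fun j _ => (hv j).2.le
  rcases winnerIndicator_eq_zero_or_one (r := r) v i with h | h <;> rw [h] <;>
    constructor <;> linarith

lemma integrable_winnerIndicator_mul (hf : Measurable f) (hpos : ∀ x ∈ Ioo 0 vbar, 0 < f x)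
    (i : Fin n) :
    Integrable (fun v : Fin n → ℝ => winnerIndicator r v i * virtualValue vbar f (v i))
      (profileLaw n vbar f) :=
  integrable_mul_virtualValue hf hpos i (measurable_winnerIndicator i).aemeasurable
    (.of_forall fun v => winnerIndicator_eq_zero_or_one v i)

/-- The expected payment of a buyer in the second-price auction is her expected virtual surplus. -/
lemma integral_secondPrice (hf : Measurable f) (hpos : ∀ x ∈ Ioo 0 vbar, 0 < f x)
    (hr : r ∈ Ioo 0 vbar) (i : Fin n) :
    ∫ v, winnerIndicator r v i * competingBid r v i ∂(profileLaw n vbar f) =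
      ∫ v, winnerIndicator r v i * virtualValue vbar f (v i) ∂(profileLaw n vbar f) := by
  refine (integral_eq_integral_update (integrable_secondPrice hr i) i).trans
    (.trans ?_ (integral_eq_integral_update (integrable_winnerIndicator_mul hf hpos i) i).symm)
  refine integral_congr_ae ?_
  filter_upwards [ae_profileLaw_mem_Ioo (vbar := vbar) (f := f)] with v hv
  simp only [competingBid_update, Function.update_self]
  symm
  -- With the others fixed, the buyer faces the posted price `competingBid r v i`, which lies in
  -- `[0, vbar]`.
  refine integral_mul_virtualValue_of_threshold hf hpos
    ⟨hr.1.le.trans (le_competingBid_reserve v i),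
      competingBid_le hr.2.le fun j _ => (hv j).2.le⟩ ?_
  filter_upwards [Measure.ae_ne (valueLaw vbar f) (competingBid r v i)] with a ha
  rcases lt_or_gt_of_ne ha with h | h
  · rw [indicator_of_notMem (by simpa using h), winnerIndicator, if_neg]
    intro hw
    have := hw.competingBid_le
    rw [competingBid_update, Function.update_self] at this
    linarith
  · rw [indicator_of_mem (show a ∈ Ici _ from h.le), winnerIndicator, if_pos]
    · rfl
    · exact isWinner_of_competingBid_lt (by simpa [competingBid_update] using h)

/-- The interim winning probability of a bid `a` above the reserve is `F a ^ (n - 1)`. -/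
lemma integral_winnerIndicator_update (i : Fin n) (a : ℝ) :
    ∫ v, winnerIndicator r (Function.update v i a) i ∂(profileLaw n vbar f) =
      (Ici r).indicator (fun a => valueCdf vbar f a ^ (n - 1)) a := by
  by_cases ha : r ≤ a
  · set s : Fin n → Set ℝ := fun j => if j = i then univ else if i ≤ j then Iic a else Iio a
      with hs
    have h : (fun v : Fin n → ℝ => winnerIndicator r (Function.update v i a) i) =
        (univ.pi s).indicator 1 := by
      funext v
      have : IsWinner r (Function.update v i a) i ↔ v ∈ univ.pi s := by
        simp only [IsWinner, Function.update_self, ha, true_and, mem_univ_pi, hs]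
        refine forall_congr' fun j => ?_
        by_cases hj : j = i
        · subst hj; simp
        · by_cases hij : i ≤ j
          · simp [hj, hij, le_iff_lt_or_eq]
          · simp [hj, hij]
      by_cases hv : v ∈ univ.pi s <;> simp [winnerIndicator, this, hv]
    have hsm : ∀ j, MeasurableSet (s j) := fun j => by
      simp only [hs]; split_ifs
      exacts [MeasurableSet.univ, measurableSet_Iic, measurableSet_Iio]
    rw [h, integral_indicator_one (MeasurableSet.univ_pi hsm),
      indicator_of_mem (show a ∈ Ici r from ha), profileLaw, Measure.real, Measure.pi_pi,
      ENNReal.toReal_prod]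
    have hprod : ∀ j, (valueLaw vbar f (s j)).toReal =
        if j = i then 1 else valueCdf vbar f a := fun j => by
      rw [valueCdf_eq_real]
      simp only [hs]
      split_ifs
      · simp
      · rfl
      · exact measureReal_congr Iio_ae_eq_Iic
    simp only [hprod]
    simp [Finset.prod_ite, Finset.filter_ne', Finset.card_erase_of_mem]
  · rw [indicator_of_notMem (show a ∉ Ici r from ha)]
    have : ∀ v : Fin n → ℝ, winnerIndicator r (Function.update v i a) i = 0 := fun v =>
      if_neg fun h => ha (by simpa using h.1)
    simp [this]

lemma integral_winnerIndicator_mul (hf : Measurable f) (hpos : ∀ x ∈ Ioo 0 vbar, 0 < f x)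
    (i : Fin n) :
    ∫ v, winnerIndicator r v i * virtualValue vbar f (v i) ∂(profileLaw n vbar f) =
      ∫ x in Ici r, valueCdf vbar f x ^ (n - 1) * virtualValue vbar f x ∂(valueLaw vbar f) := by
  refine (integral_eq_integral_update_swap (integrable_winnerIndicator_mul hf hpos i) i).trans ?_
  rw [← integral_indicator measurableSet_Ici]
  refine integral_congr_ae (.of_forall fun a => ?_)
  have h := integral_winnerIndicator_update (r := r) (vbar := vbar) (f := f) i a
  rw [profileLaw] at h
  simp only [Function.update_self, integral_mul_const, h]
  by_cases ha : a ∈ Ici r <;> simp [ha]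

lemma sum_integral_winnerIndicator_mul (hf : Measurable f)
    (hpos : ∀ x ∈ Ioo 0 vbar, 0 < f x) (hr : r ∈ Ioo 0 vbar) :
    ∑ i, ∫ v, winnerIndicator r v i * virtualValue vbar f (v i) ∂(profileLaw n vbar f) =
      optBenchmark n vbar f r := by
  rw [optBenchmark_eq hf hpos n (Ioo_subset_Icc_self hr)]
  simp [integral_winnerIndicator_mul hf hpos]

/-- The benchmark is a sum of expected second-price payments, all nonnegative. -/
lemma optBenchmark_nonneg (hf : Measurable f) (hpos : ∀ x ∈ Ioo 0 vbar, 0 < f x)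
    (hr : r ∈ Ioo 0 vbar) : 0 ≤ optBenchmark n vbar f r := by
  rw [← sum_integral_winnerIndicator_mul hf hpos hr]
  refine Finset.sum_nonneg fun i _ => ?_
  rw [← integral_secondPrice hf hpos hr]
  refine integral_nonneg fun v => mul_nonneg ?_ (hr.1.le.trans (le_competingBid_reserve v i))
  rcases winnerIndicator_eq_zero_or_one (r := r) v i with h | h <;> simp [h]

/-- The expected revenue of a feasible, IR and DSIC mechanism is at most the benchmark. -/
lemma expectedRevenue_le_optBenchmark {M : Mechanism n} (hf : Measurable f)
    (hpos : ∀ x ∈ Ioo 0 vbar, 0 < f x) (hreg : IsRegular vbar f) (hr : r ∈ Ioo 0 vbar)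
    (hr0 : virtualValue vbar f r = 0) (hF : M.IsFeasible vbar G) (hI : M.IsIR vbar G)
    (hD : M.IsDSIC vbar G) (hM : M.IsMeasurable vbar f G) :
    M.expectedRevenue vbar f G ≤ optBenchmark n vbar f r := by
  by_cases hint : Integrable (M.revenue G) (profileLaw n vbar f)
  swap
  -- A non-integrable revenue has Bochner integral 0 by convention.
  · rw [Mechanism.expectedRevenue, integral_undef hint]
    exact optBenchmark_nonneg hf hpos hr
  have hq := integrable_posPart_pay hF hI hM
  have hx (i : Fin n) : Integrable (fun v => M.alloc (observed G (truthful G v)) i *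
      virtualValue vbar f (v i)) (profileLaw n vbar f) := by
    refine integrable_mul_virtualValue hf hpos i (hM i).1 ?_
    filter_upwards [ae_profileLaw_mem_Ioo] with v hv
    exact (hF _ (validProfile_truthful fun j => Ioo_subset_Icc_self (hv j))).1 i
  calc M.expectedRevenue vbar f G
      ≤ ∫ v, ∑ i, max (M.pay (observed G (truthful G v)) i) 0 ∂(profileLaw n vbar f) := by
        refine integral_mono hint (integrable_finsetSum _ fun i _ => hq i) fun v => ?_
        exact Finset.sum_le_sum fun i _ => le_max_left _ _
    _ = ∑ i, ∫ v, max (M.pay (observed G (truthful G v)) i) 0 ∂(profileLaw n vbar f) :=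
        integral_finsetSum _ fun i _ => hq i
    _ ≤ ∑ i, ∫ v, M.alloc (observed G (truthful G v)) i * virtualValue vbar f (v i)
          ∂(profileLaw n vbar f) :=
        Finset.sum_le_sum fun i _ => integral_posPart_pay_le hf hpos hF hI hD hM i
    _ = ∫ v, ∑ i, M.alloc (observed G (truthful G v)) i * virtualValue vbar f (v i)
          ∂(profileLaw n vbar f) := (integral_finsetSum _ fun i _ => hx i).symm
    _ ≤ ∫ v, ∑ i, winnerIndicator r v i * virtualValue vbar f (v i) ∂(profileLaw n vbar f) := by
        refine integral_mono_ae (integrable_finsetSum _ fun i _ => hx i)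
          (integrable_finsetSum _ fun i _ => integrable_winnerIndicator_mul hf hpos i) ?_
        filter_upwards [ae_profileLaw_mem_Ioo] with v hv
        obtain ⟨h01, hsum, -⟩ := hF _ (validProfile_truthful fun j => Ioo_subset_Icc_self (hv j))
        refine virtualSurplus_le hreg hr hr0 hv (fun i => ?_) hsum
        rcases h01 i with h | h <;> simp [h]
    _ = ∑ i, ∫ v, winnerIndicator r v i * virtualValue vbar f (v i) ∂(profileLaw n vbar f) :=
        integral_finsetSum _ fun i _ => integrable_winnerIndicator_mul hf hpos i
    _ = optBenchmark n vbar f r := sum_integral_winnerIndicator_mul hf hpos hr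

end SecondPrice

end NetworkAuction

theorem mainTheorem8 (n : ℕ) (vbar : ℝ) (f : ℝ → ℝ) (hf : Measurable f)
    (hpos : ∀ x ∈ Set.Ioo 0 vbar, 0 < f x)
    (hprob : MeasureTheory.IsProbabilityMeasure (NetworkAuction.valueLaw vbar f))
    (hreg : NetworkAuction.IsRegular vbar f)
    (r : ℝ) (hr : r ∈ Set.Ioo 0 vbar) (hr0 : NetworkAuction.virtualValue vbar f r = 0) :
    -- Myerson's auction when all buyers are direct neighbours of the seller
    (∀ G : Digraph (NetworkAuction.Agent n),
      (∀ i : Fin n, some i ∈ NetworkAuction.neighbours G none) →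
        (NetworkAuction.myersonAuction n r).IsFeasible vbar G ∧
        (NetworkAuction.myersonAuction n r).IsIR vbar G ∧
        (NetworkAuction.myersonAuction n r).IsDSIC vbar G ∧
        (NetworkAuction.myersonAuction n r).IsMeasurable vbar f G ∧
        MeasureTheory.Integrable ((NetworkAuction.myersonAuction n r).revenue G)
          (NetworkAuction.profileLaw n vbar f) ∧
        (NetworkAuction.myersonAuction n r).expectedRevenue vbar f G =
          NetworkAuction.optBenchmark n vbar f r) ∧
    -- any mechanism on any network
    (∀ (G : Digraph (NetworkAuction.Agent n)) (M : NetworkAuction.Mechanism n),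
      M.IsFeasible vbar G → M.IsIR vbar G → M.IsDSIC vbar G → M.IsMeasurable vbar f G →
        M.expectedRevenue vbar f G ≤ NetworkAuction.optBenchmark n vbar f r) := by

  refine ⟨fun G hG => ⟨NetworkAuction.myersonAuction_isFeasible hG,
    NetworkAuction.myersonAuction_isIR hG, NetworkAuction.myersonAuction_isDSIC hG,
    NetworkAuction.myersonAuction_isMeasurable hG, ?_, ?_⟩, fun G M hF hI hD hM =>
    NetworkAuction.expectedRevenue_le_optBenchmark hf hpos hreg hr hr0 hF hI hD hM⟩
  · rw [NetworkAuction.myersonAuction_revenue hG]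
    exact MeasureTheory.integrable_finsetSum _ fun i _ =>
      NetworkAuction.integrable_secondPrice hr i
  · rw [NetworkAuction.Mechanism.expectedRevenue, NetworkAuction.myersonAuction_revenue hG,
      MeasureTheory.integral_finsetSum _ fun i _ => NetworkAuction.integrable_secondPrice hr i,
      ← NetworkAuction.sum_integral_winnerIndicator_mul hf hpos hr]
    exact Finset.sum_congr rfl fun i _ => NetworkAuction.integral_secondPrice hf hpos hr i
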